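/- Write $[n]=\{1,\dots,n\}$. A cost function on $[n]$ assigns a real number $c(x,Y)\ge 0$ to every $Y\subseteq[n]$ and $x\in Y$. For a probability distribution $\mathcal D$ on a finite set, $H(\mathcal D)=\sum_S \Pr_{\mathcal D}[S]\ln\frac{1}{\Pr_{\mathcal D}[S]}$ denotes its entropy (terms with $\Pr_{\mathcal D}[S]=0$ count as $0$). Theorem. For every $\delta>0$ there is a constant $C>0$, depending only on $\delta$, such that the following holds. Let $n,k\ge 0$ be integers with $\min(k,n-k)\ge \delta n$, let $\mathcal D$ be a probability distribution on the $k$-element subsets of $[n]$, and let $\alpha\ge 1$. Assume that for every cost function $c$ on $[n]$ satisfying $$\frac{1}{k+1}\sum_{s\in S'}c(s,S')\le 1\qquad\text{for every } S'\subseteq[n]\text{ with }|S'|=k+1,$$ one has $$\mathbb E\big[c(s,S\cup\{s\})\big]\le\alpha ,$$ where $S$ is drawn from $\mathcal D$ and then $s$ is drawn uniformly from $[n]\setminus S$. Then $$\alpha\ge C\,n\qquad\text{or}\qquad H(\mathcal D)\ge C\,\frac{n}{\alpha}\,\ln(1+\alpha).$$ -/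

import Mathlib

open scoped BigOperators

/-- The `k`-element subsets of `[n]`, with `[n]` modelled by `Fin n`. -/
abbrev KSubset (n k : ℕ) : Type := {S : Finset (Fin n) // S.card = k}

/-- The Shannon entropy (in nats) of a distribution on the `k`-subsets of `[n]`: the expectation of
the self information `-log (D S)`. A point of probability `0` contributes `0`. -/
noncomputable def entropy {n k : ℕ} (D : PMF (KSubset n k)) : ℝ :=
  ∑ S : KSubset n k, (D S).toReal * (-Real.log (D S).toReal)

/-- A cost function on `[n]` gives a nonnegative cost `c x Y` to every `Y ⊆ [n]` and `x ∈ Y`;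
the values `c x Y` with `x ∉ Y` carry no meaning and are never used. -/
def IsCostFunction {n : ℕ} (c : Fin n → Finset (Fin n) → ℝ) : Prop :=
  ∀ Y : Finset (Fin n), ∀ x ∈ Y, 0 ≤ c x Y

/-- The expected cost `c(s, S ∪ {s})` of adding `s` to `S`, where `S` is drawn from `D` and then
`s` is uniformly distributed in `[n] \ S`. -/
noncomputable def expectedInsertCost {n k : ℕ} (D : PMF (KSubset n k))
    (c : Fin n → Finset (Fin n) → ℝ) : ℝ :=
  ∑ S : KSubset n k, (D S).toReal * 𝔼 s ∈ (S.1)ᶜ, c s (insert s S.1)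

/-- For every cost function whose average over every set of size `k + 1` is at most `1`, the
expected cost of adding a uniformly random outside element to `S ∼ D` is at most `α`. -/
def SingleBatchEfficient {n k : ℕ} (D : PMF (KSubset n k)) (α : ℝ) : Prop :=
  ∀ c : Fin n → Finset (Fin n) → ℝ, IsCostFunction c →
    (∀ Y : Finset (Fin n), Y.card = k + 1 → 𝔼 s ∈ Y, c s Y ≤ 1) →
    expectedInsertCost D c ≤ α

/-!
The optimal test for batch efficiency charges the whole budget `k + 1` of each `(k + 1)`-set `Y` to
the element whose removal leaves the most probable `k`-set. Efficiency therefore says that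
`∑ Y, max_{x ∈ Y} D (Y \ {x})` is at most `α (n - k) / (k + 1)`. Slicing `D` into superlevel sets
writes it as a mixture of uniform distributions, and the bound becomes one on the average size of
the upper shadows of the slices. By a Lovász-type Kruskal-Katona theorem, a family whose upper
shadow is small relative to its size has exponentially many members, and the entropy of a mixture
is at least the average entropy of its components.
-/

section ShadowBounds

open Finset
open scoped FinsetFamily

variable {α : Type*} [DecidableEq α] {𝒜 : Finset (Finset α)} {a : α} {d k m r : ℕ}

lemma sized_memberSubfamily (h𝒜 : (𝒜 : Set (Finset α)).Sized (r + 1)) :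
    (𝒜.memberSubfamily a : Set (Finset α)).Sized r := by
  intro S hS
  obtain ⟨hmem, ha⟩ := mem_memberSubfamily.1 (mem_coe.1 hS)
  simpa only [card_insert_of_notMem ha, Nat.add_right_cancel_iff] using h𝒜 hmem

lemma shadow_memberSubfamily_subset :
    ∂ (𝒜.memberSubfamily a) ⊆ (∂ 𝒜).memberSubfamily a := by
  intro T hT
  obtain ⟨b, hb, hmem⟩ := mem_shadow_iff_insert_mem.1 hT
  obtain ⟨hmem, ha⟩ := mem_memberSubfamily.1 hmem
  obtain ⟨hab, haT⟩ : a ≠ b ∧ a ∉ T := by simpa only [mem_insert, not_or] using ha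
  refine mem_memberSubfamily.2 ⟨mem_shadow_iff_insert_mem.2 ⟨b, ?_, ?_⟩, haT⟩
  · simp only [mem_insert, hab.symm, hb, or_self, not_false_eq_true]
  · rwa [insert_comm]

lemma memberSubfamily_subset_nonMemberSubfamily_shadow :
    𝒜.memberSubfamily a ⊆ (∂ 𝒜).nonMemberSubfamily a := by
  intro T hT
  obtain ⟨hmem, ha⟩ := mem_memberSubfamily.1 hT
  exact mem_nonMemberSubfamily.2 ⟨mem_shadow_iff_insert_mem.2 ⟨a, ha, hmem⟩, ha⟩

lemma sum_card_memberSubfamily (h𝒜 : (𝒜 : Set (Finset α)).Sized r) {V : Finset α}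
    (hV : ∀ S ∈ 𝒜, S ⊆ V) : ∑ a ∈ V, #(𝒜.memberSubfamily a) = r * #𝒜 := by
  have hcard (a : α) : #(𝒜.memberSubfamily a) = #{S ∈ 𝒜 | a ∈ S} :=
    card_image_of_injOn ((erase_injOn' a).mono fun _ hS => (mem_filter.1 hS).2)
  calc ∑ a ∈ V, #(𝒜.memberSubfamily a) = ∑ S ∈ 𝒜, #{a ∈ V | a ∈ S} := by
        simp only [hcard]
        exact sum_card_bipartiteAbove_eq_sum_card_bipartiteBelow (· ∈ ·)
    _ = ∑ _S ∈ 𝒜, r := sum_congr rfl fun S hS => by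
        rw [filter_mem_eq_inter, inter_eq_right.2 (hV S hS), h𝒜 hS]
    _ = r * #𝒜 := by rw [sum_const, smul_eq_mul, mul_comm]

/-- Sum over `a` the analogous inequality between the links of `a` in `𝒜` and in `∂ 𝒜`. It holds by
induction if the link of `a` in `∂ 𝒜` is small; if that link is large, then it suffices that the
link of `a` in `𝒜` lies in the part of `∂ 𝒜` avoiding `a`. -/
theorem succ_mul_card_le_mul_card_shadow (h𝒜 : (𝒜 : Set (Finset α)).Sized (r + 1))
    (hlt : #(∂ 𝒜) < (r + m).choose r) : (r + 1) * #𝒜 ≤ m * #(∂ 𝒜) := by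
  induction r generalizing 𝒜 with
  | zero =>
    have hshadow : ∂ 𝒜 = ∅ := by simpa using hlt
    have hempty : 𝒜 = ∅ := by
      refine eq_empty_of_forall_notMem fun S hS => ?_
      obtain ⟨a, ha⟩ : S.Nonempty := card_pos.1 (by rw [h𝒜 hS]; omega)
      simpa only [hshadow, notMem_empty] using erase_mem_shadow hS ha
    simp [hempty]
  | succ r ih =>
    have hlink (a : α) :
        (r + 1) * #(𝒜.memberSubfamily a) ≤ m * #((∂ 𝒜).memberSubfamily a) := by
      rcases lt_or_ge #((∂ 𝒜).memberSubfamily a) ((r + m).choose r) with hsmall | hlarge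
      · have hsub := card_le_card (shadow_memberSubfamily_subset (𝒜 := 𝒜) (a := a))
        exact (ih (sized_memberSubfamily h𝒜) (hsub.trans_lt hsmall)).trans
          (Nat.mul_le_mul_left m hsub)
      · have hsub :=
          card_le_card (memberSubfamily_subset_nonMemberSubfamily_shadow (𝒜 := 𝒜) (a := a))
        have hpartition := card_memberSubfamily_add_card_nonMemberSubfamily a (∂ 𝒜)
        have hchoose := Nat.add_one_mul_choose_eq (r + m) r
        rw [show r + m + 1 = r + 1 + m by omega] at hchoose
        nlinarith
    have hV : ∀ S ∈ 𝒜, S ⊆ 𝒜.biUnion id := fun S hS => subset_biUnion_of_mem id hS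
    have hV' : ∀ T ∈ ∂ 𝒜, T ⊆ 𝒜.biUnion id := fun T hT =>
      let ⟨S, hS, hTS⟩ := exists_subset_of_mem_shadow hT
      hTS.trans (hV S hS)
    have hsum := sum_le_sum fun a (_ : a ∈ 𝒜.biUnion id) => hlink a
    rw [← mul_sum, ← mul_sum, sum_card_memberSubfamily h𝒜 hV,
      sum_card_memberSubfamily h𝒜.shadow hV', Nat.add_sub_cancel] at hsum
    refine Nat.le_of_mul_le_mul_left (c := r + 1) ?_ r.succ_pos
    linarith

theorem choose_le_card_of_mul_card_shadow_lt (h𝒜 : (𝒜 : Set (Finset α)).Sized r)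
    (hlt : (m + 1) * #(∂ 𝒜) < r * #𝒜) : (r + m).choose r ≤ #𝒜 := by
  cases r with
  | zero => simp at hlt
  | succ r =>
    have hshadow : (r + (m + 1)).choose r ≤ #(∂ 𝒜) := by
      by_contra! hsmall
      exact hlt.not_ge (succ_mul_card_le_mul_card_shadow h𝒜 hsmall)
    have hchoose := Nat.choose_succ_right_eq (r + (m + 1)) r
    rw [Nat.add_sub_cancel_left] at hchoose
    rw [show r + 1 + m = r + (m + 1) by omega]
    refine Nat.le_of_mul_le_mul_left (c := r + 1) ?_ r.succ_pos
    nlinarith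

variable [Fintype α]

theorem choose_le_card_of_mul_card_upShadow_lt (hα : Fintype.card α = k + d)
    (h𝒜 : (𝒜 : Set (Finset α)).Sized k) (hlt : (m + 1) * #(∂⁺ 𝒜) < d * #𝒜) :
    (d + m).choose d ≤ #𝒜 := by
  have hcompls : (𝒜ᶜˢ : Set (Finset α)).Sized d := by
    have := h𝒜.compls
    rwa [hα, Nat.add_sub_cancel_left] at this
  rw [← card_compls 𝒜]
  apply choose_le_card_of_mul_card_shadow_lt hcompls
  rwa [shadow_compls, card_compls, card_compls]

theorem log_choose_mul_sub_card_upShadow_le (hα : Fintype.card α = k + d)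
    (h𝒜 : (𝒜 : Set (Finset α)).Sized k) (m : ℕ) :
    Real.log ((d + m).choose d) * (d * #𝒜 - (m + 1) * #(∂⁺ 𝒜)) ≤
      d * (#𝒜 * Real.log #𝒜) := by
  have hlog : 0 ≤ Real.log ((d + m).choose d) := Real.log_natCast_nonneg _
  rcases lt_or_ge ((m + 1) * #(∂⁺ 𝒜)) (d * #𝒜) with hsmall | hlarge
  · have hchoose : Real.log ((d + m).choose d) ≤ Real.log #𝒜 :=
      Real.log_le_log (mod_cast Nat.choose_pos (d.le_add_right m))
        (mod_cast choose_le_card_of_mul_card_upShadow_lt hα h𝒜 hsmall)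
    calc Real.log ((d + m).choose d) * (d * #𝒜 - (m + 1) * #(∂⁺ 𝒜))
        ≤ Real.log ((d + m).choose d) * (d * #𝒜) :=
          mul_le_mul_of_nonneg_left (sub_le_self _ (by positivity)) hlog
      _ ≤ Real.log #𝒜 * (d * #𝒜) := by gcongr
      _ = d * (#𝒜 * Real.log #𝒜) := by ring
  · have hlarge' : (d * #𝒜 : ℝ) ≤ (m + 1) * #(∂⁺ 𝒜) := mod_cast hlarge
    exact (mul_nonpos_of_nonneg_of_nonpos hlog (sub_nonpos.2 hlarge')).trans
      (mul_nonneg d.cast_nonneg (mul_nonneg (Nat.cast_nonneg _) (Real.log_natCast_nonneg _)))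

end ShadowBounds

section LayerDecompositions

open Finset
open scoped FinsetFamily

variable {ι : Type*} [Fintype ι] [DecidableEq ι] {f g : ι → ℝ} {μ : Finset ι → ℝ}

lemma sum_card_mul_eq_sum_sum_filter_mem {κ : Type*} [Fintype κ] (T : κ → Finset ι)
    (w : κ → ℝ) : ∑ j, #(T j) * w j = ∑ i, ∑ j with i ∈ T j, w j := by
  simp only [sum_filter]
  rw [sum_comm]
  refine sum_congr rfl fun j _ => ?_
  rw [sum_ite_mem, univ_inter, sum_const, nsmul_eq_mul]

/-- `μ` is a layer-cake decomposition of the function `f` on a finite type: `f` is the combination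
of indicators `∑ F, μ F • 1_F` with nonnegative coefficients, and only superlevel sets of `f`, that
is, sets `F` closed under passing to larger values of `f`, have a nonzero coefficient. -/
structure IsLayerDecomposition (f : ι → ℝ) (μ : Finset ι → ℝ) : Prop where
  nonneg (F : Finset ι) : 0 ≤ μ F
  sum_eq (i : ι) : ∑ F with i ∈ F, μ F = f i
  mem_of_le {F : Finset ι} {i j : ι} : μ F ≠ 0 → i ∈ F → f i ≤ f j → j ∈ F

namespace IsLayerDecomposition

lemma add_single (hg : IsLayerDecomposition g μ) {P : Finset ι} {h : ℝ} (hh : 0 ≤ h)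
    (hfg : ∀ i, f i = g i + if i ∈ P then h else 0)
    (hmono : ∀ i j, f i ≤ f j → g i ≤ g j) (hP : ∀ i ∈ P, ∀ j, f i ≤ f j → j ∈ P) :
    IsLayerDecomposition f (μ + Pi.single P h) where
  nonneg := add_nonneg (show 0 ≤ μ from hg.nonneg) (Pi.single_nonneg.2 hh)
  sum_eq i := by
    simp only [Pi.add_apply, sum_add_distrib, hg.sum_eq, hfg i, sum_pi_single', mem_filter_univ]
  mem_of_le {F i _} hF hi hij := by
    rcases eq_or_ne F P with rfl | hFP
    · exact hP i hi _ hij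
    · rw [Pi.add_apply, Pi.single_eq_of_ne hFP, add_zero] at hF
      exact hg.mem_of_le hF hi (hmono _ _ hij)

end IsLayerDecomposition

/-- Peel off the smallest positive value of `f` from its support. -/
theorem exists_isLayerDecomposition (hf : 0 ≤ f) : ∃ μ, IsLayerDecomposition f μ := by
  induction hP : ({i | f i ≠ 0} : Finset ι) using Finset.strongInduction generalizing f with
  | H P ih =>
  have mem_P (i : ι) : i ∈ P ↔ f i ≠ 0 := by rw [← hP, mem_filter_univ]
  rcases P.eq_empty_or_nonempty with hempty | hne
  · have hzero (i : ι) : f i = 0 := by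
      by_contra hi
      simpa only [hempty, notMem_empty] using (mem_P i).2 hi
    exact ⟨0, by simp, by simp [hzero], by simp⟩
  · obtain ⟨l, hl, hmin⟩ := exists_min_image P f hne
    have hfl : 0 < f l := (hf l).lt_of_ne' ((mem_P l).1 hl)
    let g : ι → ℝ := fun i => max (f i - f l) 0
    have hssubset : ({i | g i ≠ 0} : Finset ι) ⊂ P := by
      refine (ssubset_iff_of_subset fun i hi => ?_).2 ⟨l, hl, by simp [g]⟩
      refine (mem_P i).2 fun hfi => (mem_filter_univ i).1 hi ?_
      simp [g, hfi, hfl.le]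
    obtain ⟨μ, hμ⟩ := ih _ hssubset (f := g) (fun _ => le_max_right _ _) rfl
    refine ⟨_, hμ.add_single (P := P) hfl.le (fun i => ?_)
      (fun i j hij => max_le_max_right 0 (sub_le_sub_right hij _)) fun i hi j hij => ?_⟩
    · by_cases hi : i ∈ P
      · simp [g, hi, hmin i hi]
      · have hfi : f i = 0 := not_not.1 fun h => hi ((mem_P i).2 h)
        simp [g, hi, hfi, hfl.le]
    · exact (mem_P j).2 (hfl.trans_le ((hmin i hi).trans hij)).ne'

namespace IsLayerDecomposition

lemma pos_of_mem (hμ : IsLayerDecomposition f μ) {F : Finset ι} {i : ι} (hF : μ F ≠ 0)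
    (hi : i ∈ F) : 0 < f i := by
  rw [← hμ.sum_eq i]
  exact sum_pos' (fun G _ => hμ.nonneg G)
    ⟨F, (mem_filter_univ F).2 hi, (hμ.nonneg F).lt_of_ne' hF⟩

lemma sum_card_mul (hμ : IsLayerDecomposition f μ) : ∑ F, #F * μ F = ∑ i, f i := by
  simp only [sum_card_mul_eq_sum_sum_filter_mem (fun F : Finset ι => F), hμ.sum_eq]

lemma sum_mul_log_card_le_negMulLog (hμ : IsLayerDecomposition f μ) (hf : ∑ i, f i ≤ 1) (i : ι) :
    ∑ F with i ∈ F, μ F * Real.log #F ≤ Real.negMulLog (f i) := by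
  have hfi : 0 ≤ f i := hμ.sum_eq i ▸ sum_nonneg fun F _ => hμ.nonneg F
  have hmass : ∑ F with i ∈ F, #F * μ F ≤ 1 :=
    (sum_le_univ_sum_of_nonneg fun F => mul_nonneg (Nat.cast_nonneg _) (hμ.nonneg F)).trans
      (hμ.sum_card_mul.trans_le hf)
  -- The tangent line bound `log x ≤ x - 1` at `x = #F * f i` replaces Jensen's inequality.
  have htangent : ∀ F ∈ ({F | i ∈ F} : Finset (Finset ι)),
      μ F * Real.log #F ≤ f i * (#F * μ F) - (1 + Real.log (f i)) * μ F := by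
    intro F hF
    rcases eq_or_ne (μ F) 0 with hzero | hne
    · simp [hzero]
    have hcard : (0 : ℝ) < #F := mod_cast card_pos.2 ⟨i, (mem_filter_univ F).1 hF⟩
    have hpos := hμ.pos_of_mem hne ((mem_filter_univ F).1 hF)
    have hlog := Real.log_le_sub_one_of_pos (mul_pos hcard hpos)
    rw [Real.log_mul hcard.ne' hpos.ne'] at hlog
    nlinarith [hμ.nonneg F]
  calc ∑ F with i ∈ F, μ F * Real.log #F
      ≤ ∑ F with i ∈ F, (f i * (#F * μ F) - (1 + Real.log (f i)) * μ F) := sum_le_sum htangent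
    _ = f i * ∑ F with i ∈ F, #F * μ F - (1 + Real.log (f i)) * f i := by
      rw [sum_sub_distrib, ← mul_sum, ← mul_sum, hμ.sum_eq]
    _ ≤ f i * 1 - (1 + Real.log (f i)) * f i := by gcongr
    _ = Real.negMulLog (f i) := by rw [Real.negMulLog]; ring

theorem sum_mul_card_mul_log_card_le (hμ : IsLayerDecomposition f μ) (hf : ∑ i, f i ≤ 1) :
    ∑ F, μ F * (#F * Real.log #F) ≤ ∑ i, Real.negMulLog (f i) :=
  calc ∑ F, μ F * (#F * Real.log #F) = ∑ F : Finset ι, #F * (μ F * Real.log #F) :=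
        sum_congr rfl fun _ _ => mul_left_comm _ _ _
    _ = ∑ i, ∑ F with i ∈ F, μ F * Real.log #F :=
        sum_card_mul_eq_sum_sum_filter_mem (fun F : Finset ι => F) _
    _ ≤ ∑ i, Real.negMulLog (f i) :=
        sum_le_sum fun i _ => hμ.sum_mul_log_card_le_negMulLog hf i

variable {α : Type*} [Fintype α] [DecidableEq α] {p : Finset α → ℝ}
  {μ : Finset (Finset α) → ℝ} {d k : ℕ}

/-- If `x` maximizes `p (Y.erase x)`, then a superlevel set of `p` with `Y` in its upper shadow
contains `Y.erase x`. -/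
theorem exists_sum_card_upShadow_mul_le [Nonempty α] (hμ : IsLayerDecomposition p μ) :
    ∃ t : Finset α → α, ∑ 𝒜, #(∂⁺ 𝒜) * μ 𝒜 ≤ ∑ Y with t Y ∈ Y, p (Y.erase (t Y)) := by
  have hmax (Y : Finset α) : ∃ t, ∀ x ∈ Y, t ∈ Y ∧ p (Y.erase x) ≤ p (Y.erase t) := by
    rcases Y.eq_empty_or_nonempty with rfl | hY
    · exact ⟨Classical.arbitrary α, by simp⟩
    · obtain ⟨t, ht, hle⟩ := exists_max_image Y (fun x => p (Y.erase x)) hY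
      exact ⟨t, fun x hx => ⟨ht, hle x hx⟩⟩
  choose t ht using hmax
  refine ⟨t, ?_⟩
  rw [sum_card_mul_eq_sum_sum_filter_mem (fun 𝒜 => ∂⁺ 𝒜), sum_filter]
  refine sum_le_sum fun Y _ => ?_
  have hlayer : ∀ 𝒜, Y ∈ ∂⁺ 𝒜 → μ 𝒜 ≠ 0 → t Y ∈ Y ∧ Y.erase (t Y) ∈ 𝒜 := by
    intro 𝒜 hY h𝒜
    obtain ⟨x, hx, hmem⟩ := mem_upShadow_iff_erase_mem.1 hY
    exact ⟨(ht Y x hx).1, hμ.mem_of_le h𝒜 hmem (ht Y x hx).2⟩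
  split_ifs with htY
  · rw [← hμ.sum_eq, sum_filter, sum_filter]
    refine sum_le_sum fun 𝒜 _ => ?_
    split_ifs with hY hmem hmem
    · exact le_rfl
    · exact (not_not.1 fun h𝒜 => hmem (hlayer 𝒜 hY h𝒜).2).le
    · exact hμ.nonneg 𝒜
    · exact le_rfl
  · refine (sum_eq_zero fun 𝒜 h𝒜 => ?_).le
    exact not_not.1 fun hne => htY (hlayer 𝒜 ((mem_filter_univ 𝒜).1 h𝒜) hne).1

theorem log_choose_mul_sub_sum_card_upShadow_le (hμ : IsLayerDecomposition p μ)
    (hα : Fintype.card α = k + d) (hp : ∀ S, p S ≠ 0 → #S = k) (hone : ∑ S, p S = 1) (m : ℕ) :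
    Real.log ((d + m).choose d) * (d - (m + 1) * ∑ 𝒜, #(∂⁺ 𝒜) * μ 𝒜) ≤
      d * ∑ S, Real.negMulLog (p S) := by
  set L := Real.log ((d + m).choose d)
  have hlayer (𝒜 : Finset (Finset α)) :
      μ 𝒜 * (L * (d * #𝒜 - (m + 1) * #(∂⁺ 𝒜))) ≤ μ 𝒜 * (d * (#𝒜 * Real.log #𝒜)) := by
    rcases eq_or_ne (μ 𝒜) 0 with hzero | hne
    · simp only [hzero, zero_mul, le_refl]
    · have hsized : (𝒜 : Set (Finset α)).Sized k := fun S hS => hp S (hμ.pos_of_mem hne hS).ne'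
      exact mul_le_mul_of_nonneg_left (log_choose_mul_sub_card_upShadow_le hα hsized m)
        (hμ.nonneg 𝒜)
  calc L * (d - (m + 1) * ∑ 𝒜, #(∂⁺ 𝒜) * μ 𝒜)
      = L * (d * ∑ 𝒜 : Finset (Finset α), #𝒜 * μ 𝒜 - (m + 1) * ∑ 𝒜, #(∂⁺ 𝒜) * μ 𝒜) := by
        rw [hμ.sum_card_mul, hone, mul_one]
    _ = ∑ 𝒜, μ 𝒜 * (L * (d * #𝒜 - (m + 1) * #(∂⁺ 𝒜))) := by
        rw [mul_sum, mul_sum, ← sum_sub_distrib, mul_sum]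
        exact sum_congr rfl fun 𝒜 _ => by ring
    _ ≤ ∑ 𝒜, μ 𝒜 * (d * (#𝒜 * Real.log #𝒜)) := sum_le_sum fun 𝒜 _ => hlayer 𝒜
    _ = d * ∑ 𝒜, μ 𝒜 * (#𝒜 * Real.log #𝒜) := by
        rw [mul_sum]
        exact sum_congr rfl fun 𝒜 _ => mul_left_comm _ _ _
    _ ≤ d * ∑ S, Real.negMulLog (p S) := by
        gcongr
        exact hμ.sum_mul_card_mul_log_card_le hone.le

end IsLayerDecomposition

end LayerDecompositions

section Estimates

theorem one_add_pow_le_choose {y : ℝ} (hy : 0 ≤ y) (a p : ℕ) (h : p * y ≤ a) :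
    (1 + y) ^ p ≤ (a + p).choose p := by
  induction p with
  | zero => simp
  | succ p ih =>
    push_cast at h
    have habsorb : ((a + p + 1).choose (p + 1) : ℝ) * (p + 1) = (a + p + 1) * (a + p).choose p :=
      mod_cast (Nat.add_one_mul_choose_eq (a + p) p).symm
    refine le_of_mul_le_mul_right ?_ (by positivity : (0 : ℝ) < p + 1)
    calc (1 + y) ^ (p + 1) * (p + 1) = ((p + 1) * (1 + y)) * (1 + y) ^ p := by ring
      _ ≤ (a + p + 1) * (a + p).choose p := by
        gcongr
        · linarith
        · exact ih (by linarith)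
      _ = (a + (p + 1)).choose (p + 1) * (p + 1) := habsorb.symm

lemma mul_log_one_add_le_log_one_add_mul {δ x : ℝ} (hδ : 0 ≤ δ) (hδ' : δ ≤ 1) (hx : 0 ≤ x) :
    δ * Real.log (1 + x) ≤ Real.log (1 + δ * x) := by
  rw [← Real.log_rpow (by positivity)]
  exact Real.log_le_log (by positivity)
    (rpow_one_add_le_one_add_mul_self (by linarith) hδ hδ')

end Estimates

section BatchEfficiency

open Finset
open scoped FinsetFamily

lemma sum_sum_compl_eq_sum_sum_erase {α M : Type*} [Fintype α] [DecidableEq α] [AddCommMonoid M]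
    (g : Finset α → α → M) : ∑ S, ∑ s ∈ Sᶜ, g S s = ∑ Y, ∑ x ∈ Y, g (Y.erase x) x := by
  rw [sum_sigma', sum_sigma']
  refine sum_bij' (fun p _ => ⟨insert p.2 p.1, p.2⟩) (fun q _ => ⟨q.1.erase q.2, q.2⟩)
    ?_ ?_ ?_ ?_ ?_
  · simp
  · simp
  · rintro ⟨S, s⟩ h
    simp_all
  · rintro ⟨Y, x⟩ h
    simp_all
  · rintro ⟨S, s⟩ h
    simp_all

variable {n k : ℕ}

/-- The probability mass function of `D`, extended by `0` to all subsets of `[n]`. Working with all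
subsets avoids the subtype `KSubset n k` when elements are inserted and erased. -/
noncomputable def subsetMass (D : PMF (KSubset n k)) (S : Finset (Fin n)) : ℝ :=
  if h : #S = k then (D ⟨S, h⟩).toReal else 0

lemma subsetMass_nonneg (D : PMF (KSubset n k)) : 0 ≤ subsetMass D := by
  intro S
  simp only [subsetMass]
  split_ifs
  exacts [ENNReal.toReal_nonneg, le_rfl]

lemma card_eq_of_subsetMass_ne_zero {D : PMF (KSubset n k)} {S : Finset (Fin n)}
    (h : subsetMass D S ≠ 0) : #S = k := by
  by_contra hS
  exact h (dif_neg hS)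

lemma sum_comp_subsetMass (D : PMF (KSubset n k)) {φ : Finset (Fin n) → ℝ → ℝ}
    (hφ : ∀ S, φ S 0 = 0) :
    ∑ S, φ S (subsetMass D S) = ∑ S : KSubset n k, φ S (D S).toReal := by
  refine (Fintype.sum_of_injective Subtype.val Subtype.val_injective _ _ (fun S hS => ?_)
    fun S => ?_).symm
  · rw [subsetMass, dif_neg fun h => hS ⟨⟨S, h⟩, rfl⟩, hφ]
  · rw [subsetMass, dif_pos S.2]

lemma sum_subsetMass (D : PMF (KSubset n k)) : ∑ S, subsetMass D S = 1 := by
  rw [sum_comp_subsetMass D (φ := fun _ w => w) fun _ => rfl,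
    ← ENNReal.toReal_sum fun S _ => D.apply_ne_top S, ← tsum_fintype (L := .unconditional _),
    D.tsum_coe, ENNReal.toReal_one]

lemma entropy_eq_sum_negMulLog (D : PMF (KSubset n k)) :
    entropy D = ∑ S, Real.negMulLog (subsetMass D S) := by
  rw [sum_comp_subsetMass D (φ := fun _ => Real.negMulLog) fun _ => Real.negMulLog_zero, entropy]
  exact sum_congr rfl fun S _ => by rw [Real.negMulLog, neg_mul_comm]

lemma expectedInsertCost_eq_sum_erase (D : PMF (KSubset n k)) (c : Fin n → Finset (Fin n) → ℝ) :
    expectedInsertCost D c = (∑ Y, ∑ x ∈ Y, subsetMass D (Y.erase x) * c x Y) / (n - k) := by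
  have hterm (S : Finset (Fin n)) : subsetMass D S * 𝔼 s ∈ Sᶜ, c s (insert s S) =
      (∑ s ∈ Sᶜ, subsetMass D S * c s (insert s S)) / (n - k) := by
    by_cases hS : subsetMass D S = 0
    · simp [hS]
    · have hcard : (#Sᶜ : ℝ) = n - k := by
        have hadd := card_add_card_compl S
        rw [card_eq_of_subsetMass_ne_zero hS, Fintype.card_fin] at hadd
        exact eq_sub_of_add_eq' (mod_cast hadd)
      rw [expect_eq_sum_div_card, ← mul_sum, mul_div_assoc, hcard]
  calc expectedInsertCost D c = ∑ S, subsetMass D S * 𝔼 s ∈ Sᶜ, c s (insert s S) :=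
        (sum_comp_subsetMass D (φ := fun S w => w * 𝔼 s ∈ Sᶜ, c s (insert s S))
          fun _ => zero_mul _).symm
    _ = (∑ S, ∑ s ∈ Sᶜ, subsetMass D S * c s (insert s S)) / (n - k) := by
        simp only [hterm, sum_div]
    _ = (∑ Y, ∑ x ∈ Y, subsetMass D (Y.erase x) * c x Y) / (n - k) := by
        rw [sum_sum_compl_eq_sum_sum_erase]
        congr 1
        exact sum_congr rfl fun Y _ => sum_congr rfl fun x hx => by rw [insert_erase hx]

namespace SingleBatchEfficient

variable {D : PMF (KSubset n k)} {α : ℝ}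

theorem sum_subsetMass_erase_le (hD : SingleBatchEfficient D α) (hkn : k < n)
    (t : Finset (Fin n) → Fin n) :
    (k + 1) * ∑ Y with t Y ∈ Y, subsetMass D (Y.erase (t Y)) ≤ α * (n - k) := by
  let c : Fin n → Finset (Fin n) → ℝ := fun x Y => if x = t Y then k + 1 else 0
  have hc : IsCostFunction c := fun Y x _ => by positivity
  have haverage : ∀ Y : Finset (Fin n), #Y = k + 1 → 𝔼 s ∈ Y, c s Y ≤ 1 := by
    intro Y hY
    rw [expect_eq_sum_div_card, hY, Nat.cast_succ]
    refine div_le_one_of_le₀ ?_ (by positivity)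
    rw [sum_ite_eq']
    split_ifs
    exacts [le_rfl, by positivity]
  have hpos : (0 : ℝ) < n - k := sub_pos.2 (mod_cast hkn)
  have hcost := hD c hc haverage
  rw [expectedInsertCost_eq_sum_erase, div_le_iff₀ hpos] at hcost
  refine le_trans (le_of_eq ?_) hcost
  rw [mul_sum, sum_filter]
  refine sum_congr rfl fun Y _ => ?_
  simp only [c, mul_ite, mul_zero, sum_ite_eq', mul_comm]

theorem one_sub_mul_log_choose_le_entropy (hD : SingleBatchEfficient D α) (hkn : k < n) (m : ℕ) :
    (1 - (m + 1) * α / (k + 1)) * Real.log ((n - k + m).choose m) ≤ entropy D := by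
  obtain ⟨d, rfl⟩ := Nat.exists_eq_add_of_le hkn.le
  have : Nonempty (Fin (k + d)) := ⟨⟨k, hkn⟩⟩
  have hd : (0 : ℝ) < d := Nat.cast_pos.2 (by omega)
  obtain ⟨μ, hμ⟩ := exists_isLayerDecomposition (subsetMass_nonneg D)
  have hlayers := hμ.log_choose_mul_sub_sum_card_upShadow_le (Fintype.card_fin _)
    (fun _ => card_eq_of_subsetMass_ne_zero) (sum_subsetMass D) m
  rw [← entropy_eq_sum_negMulLog, Nat.choose_symm_add] at hlayers
  obtain ⟨t, ht⟩ := hμ.exists_sum_card_upShadow_mul_le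
  have hshadow : ∑ 𝒜, #(∂⁺ 𝒜) * μ 𝒜 ≤ α * d / (k + 1) := by
    have hdual := hD.sum_subsetMass_erase_le hkn t
    rw [Nat.cast_add, add_sub_cancel_left] at hdual
    rw [le_div_iff₀' (by positivity)]
    exact (mul_le_mul_of_nonneg_left ht (by positivity)).trans hdual
  rw [Nat.add_sub_cancel_left]
  refine le_of_mul_le_mul_left ?_ hd
  calc (d : ℝ) * ((1 - (m + 1) * α / (k + 1)) * Real.log ((d + m).choose m))
      = Real.log ((d + m).choose m) * (d - (m + 1) * (α * d / (k + 1))) := by ring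
    _ ≤ Real.log ((d + m).choose m) * (d - (m + 1) * ∑ 𝒜, #(∂⁺ 𝒜) * μ 𝒜) := by
        have := Real.log_natCast_nonneg ((d + m).choose m)
        gcongr
    _ ≤ d * entropy D := hlayers

theorem mul_log_one_add_le_entropy (hD : SingleBatchEfficient D α) (hα : 0 < α) (hkn : k < n)
    (hαk : 4 * α ≤ k) :
    k / (16 * α) * Real.log (1 + 4 * α * (n - k) / k) ≤ entropy D := by
  have hk : (0 : ℝ) < k := by linarith
  have hnk : (0 : ℝ) < n - k := sub_pos.2 (mod_cast hkn)
  set y := 4 * α * (n - k) / k with hy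
  set m := ⌊k / (4 * α)⌋₊
  have hm_le : m * (4 * α) ≤ k := by
    rw [← le_div_iff₀ (by positivity)]
    exact Nat.floor_le (by positivity)
  have hm_one : (1 : ℝ) ≤ m := by
    have hone : 1 ≤ k / (4 * α) := (one_le_div (by positivity)).2 hαk
    exact_mod_cast (Nat.one_le_floor_iff _).2 hone
  have hle_m : k ≤ m * (8 * α) := by
    have hlt : k < (m + 1) * (4 * α) :=
      (div_lt_iff₀ (by positivity)).1 (Nat.lt_floor_add_one (k / (4 * α)))
    nlinarith
  have hfactor : 1 / 2 ≤ 1 - (m + 1) * α / (k + 1) := by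
    have hratio : (m + 1) * α / (k + 1) ≤ 1 / 2 := by
      rw [div_le_iff₀ (by positivity)]
      nlinarith
    linarith
  have hchoose : (1 + y) ^ m ≤ ((n - k + m).choose m : ℝ) := by
    refine one_add_pow_le_choose (by positivity) (n - k) m ?_
    rw [Nat.cast_sub hkn.le, hy, mul_div_assoc', div_le_iff₀ hk]
    nlinarith
  calc k / (16 * α) * Real.log (1 + y)
      ≤ m / 2 * Real.log (1 + y) := by
        refine mul_le_mul_of_nonneg_right ?_
          (Real.log_nonneg (le_add_of_nonneg_right (by positivity)))
        rw [div_le_div_iff₀ (by positivity) two_pos]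
        linarith
    _ = 1 / 2 * Real.log ((1 + y) ^ m) := by rw [Real.log_pow]; ring
    _ ≤ 1 / 2 * Real.log ((n - k + m).choose m) := by gcongr
    _ ≤ (1 - (m + 1) * α / (k + 1)) * Real.log ((n - k + m).choose m) :=
        mul_le_mul_of_nonneg_right hfactor (Real.log_natCast_nonneg _)
    _ ≤ entropy D := hD.one_sub_mul_log_choose_le_entropy hkn m

end SingleBatchEfficient

end BatchEfficiency

theorem mainTheorem3 (δ : ℝ) (hδ : 0 < δ) :
    ∃ C : ℝ, 0 < C ∧
      ∀ (n k : ℕ) (D : PMF (KSubset n k)) (α : ℝ), 1 ≤ α →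
        SingleBatchEfficient D α →
        δ * n ≤ min (k : ℝ) ((n : ℝ) - k) →
        C * n ≤ α ∨ C * (n / α * Real.log (1 + α)) ≤ entropy D := by
  refine ⟨δ ^ 2 / 16, by positivity, fun n k D α hα hD hmin => ?_⟩
  rw [or_iff_not_imp_left, not_le]
  intro hαn
  obtain ⟨hδk, hδnk⟩ := le_min_iff.1 hmin
  have hα_pos : 0 < α := by linarith
  have hn : (0 : ℝ) < n := pos_of_mul_pos_right (hα_pos.trans hαn) (by positivity)
  have hδ_one : δ ≤ 1 := by nlinarith
  have hkn : (k : ℝ) < n := by nlinarith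
  have hαk : 4 * α ≤ k := by nlinarith
  have hk : (0 : ℝ) < k := by linarith
  have hratio : δ * α ≤ 4 * α * (n - k) / k := by
    rw [le_div_iff₀ hk]
    nlinarith [mul_le_mul_of_nonneg_left hkn.le (mul_pos hδ hα_pos).le]
  calc δ ^ 2 / 16 * (n / α * Real.log (1 + α))
      = δ * n / (16 * α) * (δ * Real.log (1 + α)) := by field_simp
    _ ≤ k / (16 * α) * Real.log (1 + δ * α) :=
        mul_le_mul (by gcongr)
          (mul_log_one_add_le_log_one_add_mul hδ.le hδ_one hα_pos.le)
          (mul_nonneg hδ.le (Real.log_nonneg (by linarith))) (by positivity)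
    _ ≤ k / (16 * α) * Real.log (1 + 4 * α * (n - k) / k) := by gcongr
    _ ≤ entropy D := hD.mul_log_one_add_le_entropy hα_pos (mod_cast hkn) hαk
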